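/- Let $R$ be a Hasse domain of characteristic different from $2$, i.e. $R$ is either the ring of $S$-integers of a number field, where $S$ is a finite set of places containing the Archimedean ones, or the coordinate ring of a regular, integral affine algebraic curve over a finite field. Then $R$ is a Dedekind domain that is not a field; let $K$ be its fraction field. For each maximal ideal $v$ of $R$ let $K_v$ be the $v$-adic completion of $K$ and $R_v$ its valuation ring, a complete discrete valuation ring with finite residue field. Endow $R_v$ with its canonical norm, $|a|=\#(R_v/aR_v)$ for $a\neq 0$ and $|0|=0$, extended to $K_v$ by $|a/b|=|a|/|b|$. Let $n \ge 0$ and let $q\in R[x_1,\dots,x_n]$ be a quadratic form (a homogeneous polynomial of degree $2$) that is nondegenerate over $K$. Call $q$ *locally Euclidean* if for every maximal ideal $v$ of $R$ the form $q$ is Euclidean over $R_v$: for every $x\in K_v^n\setminus R_v^n$ there is $y\in R_v^n$ with $0<|q(x-y)|<1$. A *quadratic $R$-lattice* in the quadratic space $(K^n,q)$ is a finitely generated $R$-submodule $\Lambda\subset K^n$ that spans $K^n$ over $K$ and satisfies $q(\Lambda)\subset R$; it is *maximal* if it is not strictly contained in another quadratic $R$-lattice in $(K^n,q)$. Then $q$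 is locally Euclidean if and only if the quadratic $R$-lattice $\Lambda_q=R^n$ in $(K^n,q)$ is maximal. -/

import Mathlib

open IsDedekindDomain

universe u v

/-! ### Hasse domains -/

/-- `R` is (isomorphic to) the ring of `S`-integers of a number field `F`, for a finite set of
places containing the Archimedean ones; `S` below is the set of its non-Archimedean members. -/
def IsRingOfSIntegers (R : Type u) [CommRing R] : Prop :=
  ∃ (F : Type u) (_ : Field F) (_ : NumberField F)
    (S : Set (HeightOneSpectrum (NumberField.RingOfIntegers F))),
    S.Finite ∧ Nonempty (R ≃+* S.integer F)

/-- `R` is the coordinate ring of a regular integral affine curve over a finite field: a finitely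
generated algebra over a finite field which is a Dedekind domain (that is, a one-dimensional
regular domain; `IsDedekindDomain` alone allows fields, which are excluded separately). -/
def IsRegularAffineCurveRing (R : Type u) [CommRing R] : Prop :=
  ∃ (k : Type u) (_ : Field k) (_ : Finite k) (_ : Algebra k R),
    Algebra.FiniteType k R ∧ IsDedekindDomain R ∧ ¬ IsField R

/-- A Hasse domain: a ring of `S`-integers of a number field, or the coordinate ring of a regular
integral algebraic curve over a finite field. -/
class IsHasseDomain (R : Type u) [CommRing R] : Prop where
  out : IsRingOfSIntegers R ∨ IsRegularAffineCurveRing R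

/-- The ring of `S`-integers of a number field, `S` finite, is a Dedekind domain. -/
theorem isDedekindDomain_integer (F : Type u) [Field F] [NumberField F]
    (S : Set (HeightOneSpectrum (NumberField.RingOfIntegers F))) (hS : S.Finite) :
    IsDedekindDomain (S.integer F) := by
  classical
  set A := NumberField.RingOfIntegers F
  have hgen : ∀ v : HeightOneSpectrum A, ∃ a : A, a ≠ 0 ∧
      v.asIdeal ^ Fintype.card (ClassGroup A) = Ideal.span {a} := by
    intro v
    have hv : v.asIdeal ^ Fintype.card (ClassGroup A) ∈ nonZeroDivisors (Ideal A) :=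
      mem_nonZeroDivisors_of_ne_zero (pow_ne_zero _ v.ne_bot)
    have h1 : ClassGroup.mk0 ⟨_, hv⟩ = 1 := by
      have h2 : (⟨_, hv⟩ : nonZeroDivisors (Ideal A)) =
          ⟨v.asIdeal, mem_nonZeroDivisors_of_ne_zero v.ne_bot⟩ ^ Fintype.card (ClassGroup A) :=
        Subtype.ext rfl
      rw [h2, map_pow, pow_card_eq_one]
    rw [ClassGroup.mk0_eq_one_iff] at h1
    obtain ⟨a, ha⟩ := h1.principal
    refine ⟨a, ?_, ha⟩
    rintro rfl
    have h3 : v.asIdeal ^ Fintype.card (ClassGroup A) = ⊥ := by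
      simpa using ha
    exact pow_ne_zero _ v.ne_bot h3
  choose a ha0 ha using hgen
  set s : A := ∏ w ∈ hS.toFinset, a w with hs
  have hs0 : s ≠ 0 := Finset.prod_ne_zero_iff.2 fun w _ => ha0 w
  have hin : ∀ w ∈ S, s ∈ w.asIdeal := by
    intro w hw
    have h1 : a w ∈ w.asIdeal := by
      have h2 : a w ∈ w.asIdeal ^ Fintype.card (ClassGroup A) := by
        rw [ha w]; exact Ideal.mem_span_singleton_self _
      exact Ideal.pow_le_self Fintype.card_ne_zero h2
    exact Ideal.mem_of_dvd _ (Finset.dvd_prod_of_mem a (hS.mem_toFinset.2 hw)) h1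
  have hout : ∀ w, w ∉ S → s ∉ w.asIdeal := by
    intro w hw hsw
    obtain ⟨t, ht, htw⟩ := (w.isPrime.prod_mem_iff).1 hsw
    have htS := hS.mem_toFinset.1 ht
    have h1 : t.asIdeal ^ Fintype.card (ClassGroup A) ≤ w.asIdeal := by
      rw [ha t, Ideal.span_singleton_le_iff_mem]; exact htw
    have h2 : t.asIdeal ≤ w.asIdeal := Ideal.IsPrime.le_of_pow_le h1
    have h3 : t = w := HeightOneSpectrum.ext (t.isMaximal.eq_of_le w.isPrime.ne_top h2)
    exact hw (h3 ▸ htS)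
  have hloc : IsLocalization.Away s (S.integer F) := by
    have hsF : algebraMap A F s ≠ 0 := by simpa using hs0
    have hval : ∀ w, w ∉ S → w.valuation F (algebraMap A F s) = 1 := by
      intro w hw
      refine le_antisymm (w.valuation_le_one s) ?_
      by_contra h
      exact hout w hw ((w.valuation_lt_one_iff_mem s).1 (not_le.1 h))
    refine IsLocalization.Away.mk s ?_ ?_ ?_
    · refine IsUnit.of_mul_eq_one ⟨(algebraMap A F s)⁻¹, ?_⟩ ?_
      · intro w hw
        rw [map_inv₀, hval w hw, inv_one]
      · exact Subtype.ext (mul_inv_cancel₀ hsF)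
    · intro x
      have hex : ∀ w ∈ S, ∃ m : ℕ, w.valuation F (algebraMap A F s) ^ m *
          w.valuation F (x : F) ≤ 1 := by
        intro w hw
        have hlt : w.valuation F (algebraMap A F s) < 1 :=
          (w.valuation_lt_one_iff_mem s).2 (hin w hw)
        by_cases hx : w.valuation F (x : F) = 0
        · exact ⟨0, by simp [hx]⟩
        · obtain ⟨m, hm⟩ := exists_pow_lt₀ hlt (Units.mk0 _ (inv_ne_zero hx))
          exact ⟨m, (le_mul_inv_iff₀ (zero_lt_iff.2 hx)).1 (by simpa using hm.le)⟩
      choose! m hm using hex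
      have hmem : algebraMap A F s ^ (hS.toFinset.sup m) * (x : F) ∈ (algebraMap A F).range := by
        refine HeightOneSpectrum.mem_integers_of_valuation_le_one F _ fun w => ?_
        rw [map_mul, map_pow]
        by_cases hw : w ∈ S
        · refine le_trans (mul_le_mul_left ?_ _) (hm w hw)
          exact pow_le_pow_right_of_le_one' (w.valuation_le_one s)
            (Finset.le_sup (hS.mem_toFinset.2 hw))
        · rw [hval w hw, one_pow, one_mul]
          exact x.2 w hw
      obtain ⟨y, hy⟩ := hmem
      refine ⟨hS.toFinset.sup m, y, Subtype.ext ?_⟩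
      change (x : F) * (algebraMap A F s) ^ _ = algebraMap A F y
      rw [hy, mul_comm]
    · intro b c hbc
      have h1 : algebraMap A F b = algebraMap A F c := congrArg (Subtype.val : S.integer F → F) hbc
      exact ⟨0, by rw [IsFractionRing.injective A F h1]⟩
  exact IsLocalization.isDedekindDomain A
    (powers_le_nonZeroDivisors_of_noZeroDivisors hs0) (S.integer F)

instance IsHasseDomain.isDedekindDomain (R : Type u) [CommRing R] [h : IsHasseDomain R] :
    IsDedekindDomain R := by
  rcases h.out with ⟨F, _, _, S, hS, ⟨e⟩⟩ | ⟨k, _, _, _, _, hR, _⟩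
  · have := isDedekindDomain_integer F S hS
    have := e.toMulEquiv.isDomain (S.integer F)
    let _ : Algebra (S.integer F) R := (e.symm : S.integer F →+* R).toAlgebra
    have hl : IsLocalization (⊥ : Submonoid (S.integer F)) R :=
      .of_le_isUnit_of_bijective (by simp [Algebra.algebraMapSubmonoid]) e.symm.bijective
    exact IsLocalization.isDedekindDomain (S.integer F) bot_le R
  · exact hR

/-! ### Quadratic forms and quadratic lattices -/

/-- Nondegeneracy over `K` of a quadratic form `q` with coefficients in `R`: the polar form
`q (x + y) - q x - q y` on `Kⁿ` has trivial radical. -/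
def IsNondegenerateForm {R : Type u} [CommRing R] (K : Type v) [Field K] [Algebra R K] {n : ℕ}
    (q : MvPolynomial (Fin n) R) : Prop :=
  ∀ x : Fin n → K,
    (∀ y, QuadraticMap.polar (fun z : Fin n → K => MvPolynomial.aeval z q) x y = 0) → x = 0

/-- A quadratic `R`-lattice in the quadratic space `(V, Q)` over `K`: a finitely generated
`R`-submodule spanning `V` over `K`, on which `Q` takes values in `R`. -/
structure IsQuadraticLattice {R : Type u} [CommRing R] {K : Type v} [Field K] [Algebra R K]
    {V : Type*} [AddCommGroup V] [Module R V] [Module K V] [IsScalarTower R K V]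
    (Q : V → K) (L : Submodule R V) : Prop where
  isLattice : Submodule.IsLattice K L
  integral : ∀ x ∈ L, Q x ∈ Set.range (algebraMap R K)

/-- A maximal quadratic lattice: one not strictly contained in another quadratic lattice. -/
def IsMaximalQuadraticLattice {R : Type u} [CommRing R] {K : Type v} [Field K] [Algebra R K]
    {V : Type*} [AddCommGroup V] [Module R V] [Module K V] [IsScalarTower R K V]
    (Q : V → K) (L : Submodule R V) : Prop :=
  Maximal (IsQuadraticLattice Q) L

/-- The standard lattice `Rⁿ` in `Kⁿ`. -/
def standardLattice (R : Type u) [CommRing R] (K : Type v) [Field K] [Algebra R K] (n : ℕ) :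
    Submodule R (Fin n → K) :=
  Submodule.pi Set.univ fun _ => LinearMap.range (Algebra.linearMap R K)

/-! ### Norms and Euclidean forms -/

/-- The canonical norm `|a| = #(R / aR)` for `a ≠ 0`, and `|0| = 0`. -/
noncomputable def canonicalNorm (R : Type u) [CommRing R] (a : R) : ℕ :=
  open Classical in if a = 0 then 0 else Nat.card (R ⧸ Ideal.span {a})

/-- The extension of a norm `N` on `R` to the fraction field: `|a / b| = |a| / |b|`. -/
noncomputable def fracNorm {R : Type u} [CommRing R] (N : R → ℕ) {K : Type v} [Field K]
    [Algebra R K] [IsFractionRing R K] (z : K) : ℚ :=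
  (N (IsLocalization.sec (nonZeroDivisors R) z).1 : ℚ) /
    (N (IsLocalization.sec (nonZeroDivisors R) z).2 : ℚ)

/-- The extension to the fraction field does not depend on the chosen fraction. -/
theorem fracNorm_div {R : Type u} [CommRing R] [IsDomain R] (N : R → ℕ)
    (h0 : ∀ x, N x = 0 ↔ x = 0) (hmul : ∀ x y, N (x * y) = N x * N y)
    {K : Type v} [Field K] [Algebra R K] [IsFractionRing R K] (a b : R) (hb : b ≠ 0) :
    fracNorm N (algebraMap R K a / algebraMap R K b) = (N a : ℚ) / (N b : ℚ) := by
  have hinj := IsFractionRing.injective R K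
  set z := algebraMap R K a / algebraMap R K b with hz
  have hd0 : ((IsLocalization.sec (nonZeroDivisors R) z).2 : R) ≠ 0 :=
    nonZeroDivisors.ne_zero (IsLocalization.sec (nonZeroDivisors R) z).2.2
  have hsec := IsLocalization.sec_spec (nonZeroDivisors R) z
  have hbK : algebraMap R K b ≠ 0 := by simpa using hb
  have key : a * ((IsLocalization.sec (nonZeroDivisors R) z).2 : R) =
      (IsLocalization.sec (nonZeroDivisors R) z).1 * b := by
    apply hinj
    rw [map_mul, map_mul, ← hsec, hz]
    field_simp
  have hN := congrArg N key
  rw [hmul, hmul] at hN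
  have h1 : (N ((IsLocalization.sec (nonZeroDivisors R) z).2 : R) : ℚ) ≠ 0 := by
    exact_mod_cast fun h => hd0 ((h0 _).1 h)
  have h2 : (N b : ℚ) ≠ 0 := by exact_mod_cast fun h => hb ((h0 _).1 h)
  unfold fracNorm
  rw [div_eq_div_iff h1 h2]
  exact_mod_cast hN.symm

/-- A quadratic form `q` over a normed ring `(R, N)` with fraction field `K` is Euclidean if for
every `x ∈ Kⁿ \ Rⁿ` there is `y ∈ Rⁿ` with `0 < |q (x - y)| < 1`. -/
def IsEuclideanForm {R : Type u} [CommRing R] (N : R → ℕ) (K : Type v) [Field K] [Algebra R K]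
    [IsFractionRing R K] {n : ℕ} (q : MvPolynomial (Fin n) R) : Prop :=
  ∀ x : Fin n → K, x ∉ standardLattice R K n → ∃ y : Fin n → R,
    0 < fracNorm N (MvPolynomial.aeval (fun i => x i - algebraMap R K (y i)) q) ∧
      fracNorm N (MvPolynomial.aeval (fun i => x i - algebraMap R K (y i)) q) < 1

/-- `q` is locally Euclidean: for every maximal ideal `v` of `R`, the base extension of `q` to the
complete discrete valuation ring `R_v` is Euclidean for the canonical norm of `R_v`. -/
def IsLocallyEuclidean {R : Type u} [CommRing R] [IsDedekindDomain R] (K : Type v) [Field K]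
    [Algebra R K] [IsFractionRing R K] {n : ℕ} (q : MvPolynomial (Fin n) R) : Prop :=
  ∀ w : HeightOneSpectrum R,
    IsEuclideanForm (canonicalNorm (w.adicCompletionIntegers K)) (w.adicCompletion K)
      (MvPolynomial.map (algebraMap R (w.adicCompletionIntegers K)) q)

/-! ### The canonical norm of a discrete valuation ring with finite residue field -/

/-! Both properties say that a vector `x` is integral as soon as `q` is integral on its whole coset
modulo the standard lattice; one says so over every completion, the other over `K`. Over a discrete
valuation ring with finite residue field, a fraction has norm strictly between 0 and 1 exactly when
it is not integral, so a vector violating the Euclidean condition is a nonintegral vector with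
integral coset (`isEuclideanForm_canonicalNorm_iff`). Over `R`, adjoining a vector with integral
coset to `R^n` gives another quadratic lattice, and every vector of a larger quadratic lattice has
integral coset (`isMaximalQuadraticLattice_standardLattice_iff`). The two conditions are then
compared prime by prime. An integral coset stays integral after completion, being detected by `q(x)`
and the partial derivatives of `q` at `x`. Conversely, a local vector with integral coset is
congruent to a global one that is integral at all other primes
(`exists_isIntegralOnCoset_of_adicCompletion`), and the latter again has integral coset. -/

theorem canonicalNorm_ne_zero {O : Type u} [CommRing O] {a : O} (ha : a ≠ 0) :
    canonicalNorm O a = Submodule.cardQuot (Ideal.span {a}) := by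
  rw [canonicalNorm, if_neg ha, Submodule.cardQuot_apply]

section DiscreteValuationRing

variable {O : Type u} [CommRing O] [IsDomain O] [IsDiscreteValuationRing O]

/-- The exponent is the order of `a`. Multiplicativity of the norm follows because orders add. -/
theorem exists_canonicalNorm_eq_pow {ϖ : O} (hϖ : Irreducible ϖ) {a : O} (ha : a ≠ 0) :
    ∃ m, Associated a (ϖ ^ m) ∧
      canonicalNorm O a = Submodule.cardQuot (IsLocalRing.maximalIdeal O) ^ m := by
  obtain ⟨m, hm⟩ := IsDiscreteValuationRing.associated_pow_irreducible ha hϖ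
  refine ⟨m, hm, ?_⟩
  rw [canonicalNorm_ne_zero ha, Ideal.span_singleton_eq_span_singleton.2 hm,
    ← Ideal.span_singleton_pow, ← hϖ.maximalIdeal_eq,
    cardQuot_pow_of_prime (IsDiscreteValuationRing.not_a_field O)]

theorem canonicalNorm_mul (a b : O) :
    canonicalNorm O (a * b) = canonicalNorm O a * canonicalNorm O b := by
  by_cases ha : a = 0
  · simp [ha, canonicalNorm]
  by_cases hb : b = 0
  · simp [hb, canonicalNorm]
  obtain ⟨ϖ, hϖ⟩ := IsDiscreteValuationRing.exists_irreducible O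
  obtain ⟨k, hk, hka⟩ := exists_canonicalNorm_eq_pow hϖ ha
  obtain ⟨l, hl, hlb⟩ := exists_canonicalNorm_eq_pow hϖ hb
  rw [hka, hlb, ← pow_add, canonicalNorm_ne_zero (mul_ne_zero ha hb),
    Ideal.span_singleton_eq_span_singleton.2 (hk.mul_mul hl), ← pow_add,
    ← Ideal.span_singleton_pow, ← hϖ.maximalIdeal_eq,
    cardQuot_pow_of_prime (IsDiscreteValuationRing.not_a_field O)]

theorem canonicalNorm_one : canonicalNorm O 1 = 1 := by
  rw [canonicalNorm_ne_zero one_ne_zero, Ideal.span_singleton_one, Submodule.cardQuot_top]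

variable [Finite (O ⧸ IsLocalRing.maximalIdeal O)]

theorem canonicalNorm_eq_zero_iff (a : O) : canonicalNorm O a = 0 ↔ a = 0 := by
  refine ⟨fun h => ?_, fun h => if_pos h⟩
  by_contra ha
  obtain ⟨ϖ, hϖ⟩ := IsDiscreteValuationRing.exists_irreducible O
  obtain ⟨m, -, hm⟩ := exists_canonicalNorm_eq_pow hϖ ha
  rw [hm, Submodule.cardQuot_apply] at h
  exact pow_ne_zero m Nat.card_pos.ne' h

theorem one_lt_canonicalNorm {a : O} (ha : a ≠ 0) (hu : ¬ IsUnit a) : 1 < canonicalNorm O a := by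
  refine lt_of_le_of_ne (Nat.one_le_iff_ne_zero.2 fun h => ha ((canonicalNorm_eq_zero_iff a).1 h))
    fun h => hu ?_
  rw [canonicalNorm_ne_zero ha, eq_comm, Submodule.cardQuot_eq_one_iff] at h
  exact Ideal.span_singleton_eq_top.1 h

/-- The fractions of norm strictly between `0` and `1` are those outside the valuation ring. -/
theorem fracNorm_canonicalNorm_mem_Ioo_iff {E : Type v} [Field E] [Algebra O E]
    [IsFractionRing O E] (z : E) :
    (0 < fracNorm (canonicalNorm O) z ∧ fracNorm (canonicalNorm O) z < 1) ↔
      z ∉ Set.range (algebraMap O E) := by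
  have hdiv := fun (a b : O) (hb : b ≠ 0) => fracNorm_div (canonicalNorm O)
    canonicalNorm_eq_zero_iff canonicalNorm_mul (K := E) a b hb
  constructor
  · rintro ⟨h0, h1⟩ ⟨a, rfl⟩
    have h := hdiv a 1 one_ne_zero
    rw [map_one, div_one, canonicalNorm_one, Nat.cast_one, div_one] at h
    rw [h] at h0 h1
    have h0' : 0 < canonicalNorm O a := by exact_mod_cast h0
    have h1' : canonicalNorm O a < 1 := by exact_mod_cast h1
    omega
  · intro hz
    -- A nonintegral `z` has integral inverse `b`, a nonunit, so `|z| = 1/|b|` with `|b| > 1`.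
    obtain ⟨b, hb⟩ := (ValuationRing.isInteger_or_isInteger O z).resolve_left hz
    have hz0 : z ≠ 0 := by
      rintro rfl
      exact hz ⟨0, map_zero _⟩
    have hb0 : b ≠ 0 := by
      rintro rfl
      rw [map_zero, eq_comm, inv_eq_zero] at hb
      exact hz0 hb
    have hzb : z = algebraMap O E 1 / algebraMap O E b := by
      rw [map_one, hb, one_div, inv_inv]
    have hbu : ¬ IsUnit b := by
      intro hu
      obtain ⟨c, hc⟩ := hu.exists_right_inv
      refine hz ⟨c, ?_⟩
      rw [hzb, map_one, eq_div_iff (by rw [hb]; exact inv_ne_zero hz0), ← map_mul, mul_comm, hc,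
        map_one]
    have hN : (1 : ℚ) < canonicalNorm O b := by exact_mod_cast one_lt_canonicalNorm hb0 hbu
    rw [hzb, hdiv 1 b hb0, canonicalNorm_one, Nat.cast_one]
    exact ⟨by positivity, (div_lt_one (by linarith)).2 hN⟩

end DiscreteValuationRing

/-! ### Approximation in Dedekind domains -/

/-- Given a height one prime `w` and `b ≠ 0`, some element is congruent to `1` modulo the `w`-part
of `b` and divisible by the part of `b` prime to `w`. -/
theorem exists_valuation_sub_one_le {A : Type u} [CommRing A] [IsDedekindDomain A]
    (F : Type v) [Field F] [Algebra A F] [IsFractionRing A F]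
    (w : HeightOneSpectrum A) {b : A} (hb : b ≠ 0) :
    ∃ s : A, w.valuation F (algebraMap A F (s - 1)) ≤ w.valuation F (algebraMap A F b) ∧
      ∀ t : HeightOneSpectrum A, t ≠ w →
        t.valuation F (algebraMap A F s) ≤ t.valuation F (algebraMap A F b) := by
  have hspan : Ideal.span {b} ≠ 0 := by simpa using hb
  obtain ⟨J, hJ, hwJ⟩ :=
    (FiniteMultiplicity.of_prime_left w.prime hspan).exists_eq_pow_mul_and_not_dvd
  set k := multiplicity w.asIdeal (Ideal.span {b})
  rw [Ideal.dvd_iff_le] at hwJ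
  -- With `(b) = w^k J`, split `1 = r + s` with `r ∈ w^k` and `s ∈ J`. To bound `r` at `w`, or `s`
  -- at `t ≠ w`, multiply by an element of the complementary factor that is a unit at that prime.
  have hle : ∀ (t : HeightOneSpectrum A) (x c : A), x * c ∈ Ideal.span {b} → c ∉ t.asIdeal →
      t.valuation F (algebraMap A F x) ≤ t.valuation F (algebraMap A F b) := by
    intro t x c hxc hc
    obtain ⟨y, hy⟩ := Ideal.mem_span_singleton.1 hxc
    have hc1 : t.valuation F (algebraMap A F c) = 1 := (t.valuation_eq_one_iff_notMem (K := F)).2 hc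
    calc t.valuation F (algebraMap A F x)
        = t.valuation F (algebraMap A F b) * t.valuation F (algebraMap A F y) := by
          rw [← map_mul, ← map_mul, ← hy, map_mul, map_mul, hc1, mul_one]
      _ ≤ t.valuation F (algebraMap A F b) := mul_le_of_le_one_right' (t.valuation_le_one y)
  have hcop : w.asIdeal ^ k ⊔ J = ⊤ := by
    rw [← Ideal.isCoprime_iff_sup_eq]
    refine IsCoprime.pow_left ?_
    rw [Ideal.isCoprime_iff_sup_eq]
    exact w.isMaximal.1.2 _ (left_lt_sup.2 hwJ)
  obtain ⟨r, hr, s, hs, hrs⟩ := Submodule.mem_sup.1 (hcop ▸ Submodule.mem_top (x := (1 : A)))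
  refine ⟨s, ?_, fun t ht => ?_⟩
  · obtain ⟨c, hcJ, hcw⟩ := SetLike.not_le_iff_exists.1 hwJ
    have : s - 1 = -r := by rw [← hrs]; ring
    rw [this, map_neg, Valuation.map_neg]
    exact hle w r c (hJ ▸ Ideal.mul_mem_mul hr hcJ) hcw
  · have hnot : ¬ w.asIdeal ^ k ≤ t.asIdeal := fun h =>
      ht (HeightOneSpectrum.ext
        (w.isMaximal.eq_of_le t.isPrime.ne_top (Ideal.IsPrime.le_of_pow_le h))).symm
    obtain ⟨c, hcJ, hcw⟩ := SetLike.not_le_iff_exists.1 hnot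
    exact hle t s c (hJ ▸ mul_comm c s ▸ Ideal.mul_mem_mul hcJ hs) hcw

/-- A vector over the fraction field can be made integral away from `w` by a change that is
integral at `w`. -/
theorem exists_forall_valuation_le_one {A : Type u} [CommRing A] [IsDedekindDomain A]
    {F : Type v} [Field F] [Algebra A F] [IsFractionRing A F]
    (w : HeightOneSpectrum A) {ι : Type*} [Finite ι] (x : ι → F) :
    ∃ x' : ι → F, (∀ i, w.valuation F (x' i - x i) ≤ 1) ∧
      ∀ t : HeightOneSpectrum A, t ≠ w → ∀ i, t.valuation F (x' i) ≤ 1 := by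
  obtain ⟨b, hb⟩ := IsLocalization.exist_integer_multiples_of_finite (nonZeroDivisors A) x
  have hb0 : (b : A) ≠ 0 := nonZeroDivisors.ne_zero b.2
  choose a ha using hb
  obtain ⟨s, hsw, hst⟩ := exists_valuation_sub_one_le F w hb0
  have hbF : algebraMap A F b ≠ 0 := by simp [hb0]
  have key : ∀ (t : HeightOneSpectrum A) (c : A),
      t.valuation F (algebraMap A F c) ≤ t.valuation F (algebraMap A F b) →
      ∀ i, t.valuation F (algebraMap A F c * x i) ≤ 1 := by
    intro t c hc i
    have hx : x i = algebraMap A F (a i) / algebraMap A F b := by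
      rw [ha i, Algebra.smul_def, mul_div_cancel_left₀ _ hbF]
    have hpos : 0 < t.valuation F (algebraMap A F b) := by
      rw [zero_lt_iff]; exact (Valuation.ne_zero_iff _).2 hbF
    rw [hx, mul_div_left_comm, map_mul, map_div₀]
    exact mul_le_one' (t.valuation_le_one _) ((div_le_one₀ hpos).2 hc)
  refine ⟨fun i => algebraMap A F s * x i, fun i => ?_, fun t ht i => key t s (hst t ht) i⟩
  have : algebraMap A F s * x i - x i = algebraMap A F (s - 1) * x i := by
    rw [map_sub, map_one]; ring
  rw [this]
  exact key w (s - 1) hsw i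

/-! ### Finiteness of residue fields -/

/-- The ring of `S`-integers of the fraction field of a Dedekind domain with finite quotients has
finite residue fields. -/
theorem finite_quotient_integer {A : Type u} [CommRing A] [IsDedekindDomain A]
    [Ring.HasFiniteQuotients A] (F : Type v) [Field F] [Algebra A F] [IsFractionRing A F]
    (S : Set (HeightOneSpectrum A)) {P : Ideal (S.integer F)} (hP : P.IsPrime) (hP0 : P ≠ ⊥) :
    Finite (S.integer F ⧸ P) := by
  have hcoe : ∀ a : A, (algebraMap A (S.integer F) a : F) = algebraMap A F a := fun _ => rfl
  have hne : P.under A ≠ ⊥ := by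
    obtain ⟨x, hx, hx0⟩ := Submodule.exists_mem_ne_zero_of_ne_bot hP0
    obtain ⟨a, b, hb, hab⟩ := IsFractionRing.div_surjective (A := A) (x : F)
    have hbF : algebraMap A F b ≠ 0 := by simpa using nonZeroDivisors.ne_zero hb
    rw [div_eq_iff hbF] at hab
    have hmem : algebraMap A (S.integer F) a ∈ P := by
      have : algebraMap A (S.integer F) a = x * algebraMap A (S.integer F) b := Subtype.ext hab
      exact this ▸ P.mul_mem_right _ hx
    intro h
    have ha : a = 0 := (Ideal.mem_bot).1 (h ▸ Ideal.mem_comap.2 hmem)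
    rw [ha, map_zero, eq_comm, mul_eq_zero, or_iff_left hbF] at hab
    exact hx0 (Subtype.ext hab)
  let w : HeightOneSpectrum A := ⟨P.under A, inferInstance, hne⟩
  have hwmem : ∀ a : A, a ∈ w.asIdeal ↔ algebraMap A (S.integer F) a ∈ P := fun _ => Iff.rfl
  -- If `w ∈ S`, take `b ∈ w` nonzero and `s` as in the approximation lemma. Then `s / b` is an
  -- `S`-integer, nothing being required at `w`, so `s ∈ P ∩ A = w`; but `s ≡ 1` modulo `w`.
  have hwS : w ∉ S := by
    intro hw
    obtain ⟨b, hb, hb0⟩ := Submodule.exists_mem_ne_zero_of_ne_bot hne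
    obtain ⟨s, hsw, hst⟩ := exists_valuation_sub_one_le F w hb0
    have hbF : algebraMap A F b ≠ 0 := by simpa using hb0
    have hs : s ∈ w.asIdeal := by
      let y : S.integer F := ⟨algebraMap A F s / algebraMap A F b, fun t ht => by
        have hpos : 0 < t.valuation F (algebraMap A F b) := by
          rw [zero_lt_iff]; exact (Valuation.ne_zero_iff _).2 hbF
        rw [map_div₀]
        exact (div_le_one₀ hpos).2 (hst t fun h => ht (h ▸ hw))⟩
      have : algebraMap A (S.integer F) s = y * algebraMap A (S.integer F) b :=
        Subtype.ext (div_mul_cancel₀ _ hbF).symm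
      exact (hwmem s).2 (this ▸ P.mul_mem_left _ hb)
    have hs1 : s - 1 ∈ w.asIdeal :=
      (w.valuation_lt_one_iff_mem (K := F) _).1
        (hsw.trans_lt ((w.valuation_lt_one_iff_mem (K := F) b).2 hb))
    exact w.isPrime.ne_top ((Ideal.eq_top_iff_one _).2 (by simpa using sub_mem hs hs1))
  have : Finite (A ⧸ P.under A) := Ring.HasFiniteQuotients.finiteQuotient hne
  refine Finite.of_surjective
    (Ideal.quotientMap P (algebraMap A (S.integer F)) (le_refl (P.under A))) ?_
  rintro ⟨x⟩
  -- Write `x = m / d` with `d ∉ w`; if `e` inverts `d` modulo `w`, then `m * e` represents the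
  -- class of `x`.
  obtain ⟨m, ⟨d, hd⟩, hx⟩ := w.exists_primeCompl_mul_eq_of_integer (x : F) (x.2 w hwS)
  obtain ⟨e, he⟩ := Ideal.IsMaximal.exists_inv w.isMaximal hd
  obtain ⟨i, hi, hei⟩ := he
  refine ⟨Ideal.Quotient.mk _ (m * e), ?_⟩
  rw [Ideal.quotientMap_mk]
  refine (Ideal.Quotient.eq).2 ?_
  have hxm : x * algebraMap A (S.integer F) d = algebraMap A (S.integer F) m := Subtype.ext hx
  have : algebraMap A (S.integer F) (m * e) - x = - (x * algebraMap A (S.integer F) i) := by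
    have h1 := congrArg (algebraMap A (S.integer F)) hei
    rw [map_add, map_mul, map_one] at h1
    rw [map_mul, ← hxm]
    linear_combination x * h1
  rw [this]
  exact neg_mem (P.mul_mem_left _ ((hwmem i).1 hi))

theorem IsHasseDomain.finite_quotient {R : Type u} [CommRing R] [h : IsHasseDomain R]
    (w : HeightOneSpectrum R) : Finite (R ⧸ w.asIdeal) := by
  rcases h.out with ⟨F, _, _, S, hS, ⟨e⟩⟩ | ⟨k, _, _, _, _, -, -⟩
  · have hprime : (w.asIdeal.map (e : R →+* S.integer F)).IsPrime :=
      Ideal.map_isPrime_of_equiv e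
    have hne : w.asIdeal.map (e : R →+* S.integer F) ≠ ⊥ := fun h0 =>
      w.ne_bot ((Ideal.map_eq_bot_iff_of_injective e.injective).1 h0)
    have := finite_quotient_integer F S hprime hne
    exact Finite.of_equiv _ (Ideal.quotientEquiv w.asIdeal _ e rfl).symm.toEquiv
  · have := w.isMaximal
    let _ := Ideal.Quotient.field w.asIdeal
    -- Zariski's lemma: a field finitely generated as a `k`-algebra is a finite extension of `k`.
    have := finite_of_finite_type_of_isJacobsonRing k (R ⧸ w.asIdeal)
    exact Module.finite_of_finite k

/-! ### Density and residue fields of adic completions -/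

section AdicCompletion

variable {R : Type u} [CommRing R] [IsDedekindDomain R] {K : Type v} [Field K] [Algebra R K]
  [IsFractionRing R K] (w : HeightOneSpectrum R)

theorem exists_valued_sub_coe_lt_one (x : w.adicCompletion K) :
    ∃ k : K, Valued.v (x - (k : w.adicCompletion K)) < 1 := by
  have hopen : IsOpen {y : w.adicCompletion K | Valued.v (x - y) < 1} := by
    have h1 : IsOpen {z : w.adicCompletion K | Valued.v z < 1} := by
      simpa only [Valuation.restrict_lt_one_iff] using
        Valued.isOpen_ball (w.adicCompletion K) 1
    exact h1.preimage (continuous_const.sub continuous_id)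
  obtain ⟨k, hk⟩ := (HeightOneSpectrum.denseRange_algebraMap K w).exists_mem_open hopen
    ⟨x, by simp⟩
  exact ⟨k, hk⟩

/-- Modulo the maximal ideal, an integer of the completion is approximated by an element of `K` by
density, then by one of `R`; hence `R/w` surjects onto the residue field. -/
theorem finite_quotient_maximalIdeal_adicCompletionIntegers [Finite (R ⧸ w.asIdeal)] :
    Finite (w.adicCompletionIntegers K ⧸
      IsLocalRing.maximalIdeal (w.adicCompletionIntegers K)) := by
  have hmax : ∀ x : w.adicCompletionIntegers K,
      x ∈ IsLocalRing.maximalIdeal (w.adicCompletionIntegers K) ↔ Valued.v x.1 < 1 := fun x =>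
    Valuation.mem_maximalIdeal_iff _ _
  have hle : w.asIdeal ≤ (IsLocalRing.maximalIdeal (w.adicCompletionIntegers K)).comap
      (algebraMap R (w.adicCompletionIntegers K)) := by
    intro a ha
    rw [Ideal.mem_comap, hmax, HeightOneSpectrum.algebraMap_adicCompletionIntegers_apply,
      HeightOneSpectrum.valuedAdicCompletion_eq_valuation']
    exact (w.valuation_lt_one_iff_mem a).2 ha
  refine Finite.of_surjective (Ideal.quotientMap _ _ hle) ?_
  rintro ⟨x⟩
  obtain ⟨k, hk⟩ := exists_valued_sub_coe_lt_one w x.1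
  have hk1 : w.valuation K k ≤ 1 := by
    rw [← HeightOneSpectrum.valuedAdicCompletion_eq_valuation',
      ← sub_sub_cancel x.1 (k : w.adicCompletion K)]
    exact Valuation.map_sub_le _ x.2 hk.le
  obtain ⟨a, ha⟩ := w.exists_valuation_sub_lt_of_integer hk1 1
  refine ⟨Ideal.Quotient.mk _ a, ?_⟩
  rw [Ideal.quotientMap_mk]
  refine Ideal.Quotient.eq.2 ((hmax _).2 ?_)
  have h1 : Valued.v ((algebraMap R K a - k : K) : w.adicCompletion K) < 1 := by
    rw [HeightOneSpectrum.valuedAdicCompletion_eq_valuation']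
    exact ha
  have h2 : ((algebraMap R (w.adicCompletionIntegers K) a - x : w.adicCompletionIntegers K) :
      w.adicCompletion K) =
      algebraMap K (w.adicCompletion K) (algebraMap R K a - k) -
        (x.1 - algebraMap K (w.adicCompletion K) k) := by
    rw [map_sub]
    change algebraMap K (w.adicCompletion K) (algebraMap R K a) - x.1 = _
    ring
  rw [h2]
  exact Valuation.map_sub_lt _ h1 hk

end AdicCompletion

/-! ### Polynomial identities for quadratic forms -/

section Quadratic

open MvPolynomial

variable {R : Type u} [CommRing R] {n : ℕ}

theorem aeval_add_smul_of_isHomogeneous_one {p : MvPolynomial (Fin n) R} (hp : p.IsHomogeneous 1)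
    {A : Type v} [CommRing A] [Algebra R A] (x y : Fin n → A) (r : A) :
    aeval (x + r • y) p = aeval x p + r * aeval y p ∧
      ∑ j, y j * aeval x (pderiv j p) = aeval y p := by
  have hp' : p ∈ Submodule.span R (Set.range (X : Fin n → MvPolynomial (Fin n) R)) := by
    rw [← homogeneousSubmodule_one_eq_span_X]
    exact hp
  clear hp
  induction hp' using Submodule.span_induction with
  | mem p h =>
    obtain ⟨i, rfl⟩ := h
    refine ⟨by simp, ?_⟩
    simp [pderiv_X, Pi.single_apply, apply_ite]
  | zero => simp
  | add p q _ _ hp hq =>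
    simp only [map_add, hp, hq, mul_add, Finset.sum_add_distrib]
    exact ⟨by ring, trivial⟩
  | smul c p _ hp =>
    simp only [map_smul, Derivation.map_smul, hp, mul_smul_comm, ← Finset.smul_sum, smul_add]
    exact ⟨trivial, trivial⟩

/-- Second order Taylor expansion of a quadratic form. -/
theorem aeval_add_smul_of_isHomogeneous_two {q : MvPolynomial (Fin n) R} (hq : q.IsHomogeneous 2)
    {A : Type v} [CommRing A] [Algebra R A] (x y : Fin n → A) (r : A) :
    aeval (x + r • y) q =
      aeval x q + r * ∑ j, y j * aeval x (pderiv j q) + r ^ 2 * aeval y q := by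
  -- A quadratic form is a sum of products of two linear forms, so the product rule reduces the
  -- expansion to the linear case, with no division by 2.
  have hq' : q ∈ homogeneousSubmodule (Fin n) R 1 * homogeneousSubmodule (Fin n) R 1 := by
    rw [← sq, homogeneousSubmodule_one_pow]
    exact hq
  clear hq
  induction hq' using Submodule.mul_induction_on' with
  | mem_mul_mem f hf g hg =>
    obtain ⟨hf1, hf2⟩ := aeval_add_smul_of_isHomogeneous_one hf x y r
    obtain ⟨hg1, hg2⟩ := aeval_add_smul_of_isHomogeneous_one hg x y r
    have hsum : ∑ j, y j * aeval x (pderiv j (f * g)) =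
        aeval x g * aeval y f + aeval x f * aeval y g := by
      rw [← hf2, ← hg2, Finset.mul_sum, Finset.mul_sum, ← Finset.sum_add_distrib]
      refine Finset.sum_congr rfl fun j _ => ?_
      rw [pderiv_mul, map_add, map_mul, map_mul]
      ring
    rw [hsum, map_mul, map_mul, map_mul, hf1, hg1]
    ring
  | add f _ g _ hf hg =>
    simp only [map_add, hf, hg, mul_add, Finset.sum_add_distrib]
    ring

/-- The form `q` takes integral values on the coset of the standard lattice through `x`. -/
def IsIntegralOnCoset {E : Type v} [CommRing E] [Algebra R E] (q : MvPolynomial (Fin n) R)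
    (x : Fin n → E) : Prop :=
  ∀ y : Fin n → R, aeval (fun i => x i - algebraMap R E (y i)) q ∈ (algebraMap R E).range

/-- By the Taylor expansion, the derivatives are the coefficients of the term linear in `y`. The
criterion no longer quantifies over the lattice, so it passes to completions, whose cosets are
larger. -/
theorem isIntegralOnCoset_iff {E : Type v} [CommRing E] [Algebra R E]
    {q : MvPolynomial (Fin n) R} (hq : q.IsHomogeneous 2) (x : Fin n → E) :
    IsIntegralOnCoset q x ↔ aeval x q ∈ (algebraMap R E).range ∧
      ∀ j, aeval x (pderiv j q) ∈ (algebraMap R E).range := by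
  have hint : ∀ y : Fin n → R, aeval (fun i => algebraMap R E (y i)) q ∈ (algebraMap R E).range :=
    fun y => ⟨aeval y q, (aeval_algebraMap_apply E y q).symm⟩
  have hexp : ∀ y : Fin n → R, aeval (fun i => x i - algebraMap R E (y i)) q =
      aeval x q - ∑ j, algebraMap R E (y j) * aeval x (pderiv j q) +
        aeval (fun i => algebraMap R E (y i)) q := by
    intro y
    have h := aeval_add_smul_of_isHomogeneous_two hq x (fun i => algebraMap R E (y i)) (-1)
    have h' : x + (-1 : E) • (fun i => algebraMap R E (y i)) =
        fun i => x i - algebraMap R E (y i) := by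
      ext i
      simp [sub_eq_add_neg]
    rw [← h', h]
    ring
  constructor
  · intro h
    have h0 : aeval x q ∈ (algebraMap R E).range := by simpa using h 0
    refine ⟨h0, fun j => ?_⟩
    -- Translating by a basis vector isolates a single derivative.
    have h1 := hexp (Pi.single j 1)
    rw [Finset.sum_eq_single j (fun i _ hi => by simp [hi]) (by simp), Pi.single_eq_same, map_one,
      one_mul] at h1
    have h2 : aeval x (pderiv j q) = aeval x q +
        aeval (fun i => algebraMap R E ((Pi.single j 1 : Fin n → R) i)) q -
        aeval (fun i => x i - algebraMap R E ((Pi.single j 1 : Fin n → R) i)) q := by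
      rw [h1]
      ring
    rw [h2]
    exact sub_mem (add_mem h0 (hint _)) (h _)
  · rintro ⟨h0, h1⟩ y
    rw [hexp]
    exact add_mem (sub_mem h0 (sum_mem fun j _ => mul_mem ⟨_, rfl⟩ (h1 j))) (hint y)

theorem IsIntegralOnCoset.sub_algebraMap {E : Type v} [CommRing E] [Algebra R E]
    {q : MvPolynomial (Fin n) R} {x : Fin n → E} (h : IsIntegralOnCoset q x) (z : Fin n → R) :
    IsIntegralOnCoset q fun i => x i - algebraMap R E (z i) := by
  intro y
  have := h (z + y)
  simpa only [Pi.add_apply, map_add, ← sub_sub] using this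

end Quadratic

/-! ### Maximality and the Euclidean property as conditions on integral cosets -/

theorem mem_standardLattice {R : Type u} [CommRing R] {K : Type v} [Field K] [Algebra R K] {n : ℕ}
    {x : Fin n → K} : x ∈ standardLattice R K n ↔ ∀ i, x i ∈ (algebraMap R K).range := by
  simp [standardLattice, Submodule.mem_pi]

theorem mem_standardLattice_iff_exists {R : Type u} [CommRing R] {K : Type v} [Field K]
    [Algebra R K] {n : ℕ} {x : Fin n → K} :
    x ∈ standardLattice R K n ↔ ∃ y : Fin n → R, x = fun i => algebraMap R K (y i) := by
  rw [mem_standardLattice]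
  constructor
  · intro h
    choose y hy using h
    exact ⟨y, funext fun i => (hy i).symm⟩
  · rintro ⟨y, rfl⟩ i
    exact ⟨y i, rfl⟩

theorem isLattice_standardLattice (R : Type u) [CommRing R] (K : Type v) [Field K] [Algebra R K]
    (n : ℕ) : Submodule.IsLattice K (standardLattice R K n) where
  fg := Submodule.fg_pi fun _ => (Submodule.fg_top (LinearMap.range _)).1 Module.Finite.fg_top
  span_eq_top := by
    rw [eq_top_iff, ← (Pi.basisFun K (Fin n)).span_eq, Submodule.span_le]
    rintro _ ⟨i, rfl⟩
    refine Submodule.subset_span (mem_standardLattice_iff_exists.2 ⟨Pi.single i 1, ?_⟩)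
    ext j
    by_cases h : j = i <;> simp [h]

theorem isMaximalQuadraticLattice_standardLattice_iff {R : Type u} [CommRing R] {K : Type v}
    [Field K] [Algebra R K] {n : ℕ} {q : MvPolynomial (Fin n) R} (hq : q.IsHomogeneous 2) :
    IsMaximalQuadraticLattice (fun x : Fin n → K => MvPolynomial.aeval x q)
        (standardLattice R K n) ↔
      ∀ x : Fin n → K, IsIntegralOnCoset q x → x ∈ standardLattice R K n := by
  have hstd : IsQuadraticLattice (fun x : Fin n → K => MvPolynomial.aeval x q)
      (standardLattice R K n) := by
    refine ⟨isLattice_standardLattice R K n, fun x hx => ?_⟩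
    obtain ⟨y, rfl⟩ := mem_standardLattice_iff_exists.1 hx
    exact ⟨MvPolynomial.aeval y q, (MvPolynomial.aeval_algebraMap_apply K y q).symm⟩
  constructor
  · intro hmax x hx
    have hx0 : MvPolynomial.aeval x q ∈ (algebraMap R K).range := by simpa using hx 0
    have hlat : IsQuadraticLattice (fun x : Fin n → K => MvPolynomial.aeval x q)
        (standardLattice R K n ⊔ Submodule.span R {x}) := by
      have := isLattice_standardLattice R K n
      refine ⟨Submodule.IsLattice.of_le_of_isLattice_of_fg K le_sup_left
        (Submodule.FG.sup this.fg (Submodule.fg_span_singleton x)), fun z hz => ?_⟩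
      obtain ⟨y, hy, _, hrx, rfl⟩ := Submodule.mem_sup.1 hz
      obtain ⟨r, rfl⟩ := Submodule.mem_span_singleton.1 hrx
      have hyq : MvPolynomial.aeval y q ∈ (algebraMap R K).range := hstd.integral y hy
      have hxy : MvPolynomial.aeval (y + x) q ∈ (algebraMap R K).range := by
        obtain ⟨y', rfl⟩ := mem_standardLattice_iff_exists.1 hy
        -- Cosets are written `x - y`, hence the sign.
        have := hx (-y')
        simpa [add_comm, Pi.add_def] using this
      have h1 := aeval_add_smul_of_isHomogeneous_two hq y x 1
      have h2 := aeval_add_smul_of_isHomogeneous_two hq y x (algebraMap R K r)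
      rw [one_smul, one_mul, one_pow, one_mul] at h1
      -- The linear term is the polar form `q(y + x) - q(y) - q(x)`, integral because `y + x` lies
      -- in the coset of `x`; scaling `x` by `r` preserves integrality.
      have h3 : MvPolynomial.aeval (y + r • x) q = MvPolynomial.aeval y q +
          algebraMap R K r * (MvPolynomial.aeval (y + x) q - MvPolynomial.aeval y q -
            MvPolynomial.aeval x q) + algebraMap R K r ^ 2 * MvPolynomial.aeval x q := by
        rw [← algebraMap_smul K r x, h2, h1]
        ring
      change MvPolynomial.aeval (y + r • x) q ∈ (algebraMap R K).range
      rw [h3]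
      exact add_mem (add_mem hyq (mul_mem ⟨r, rfl⟩ (sub_mem (sub_mem hxy hyq) hx0)))
        (mul_mem (pow_mem (RingHom.mem_range_self _ r) 2) hx0)
    exact hmax.2 hlat le_sup_left
      (Submodule.mem_sup_right (Submodule.mem_span_singleton_self x))
  · intro h
    refine ⟨hstd, fun L hL hle x hx => h x fun y => ?_⟩
    exact hL.integral _ (sub_mem hx (hle (mem_standardLattice_iff_exists.2 ⟨y, rfl⟩)))

theorem isEuclideanForm_canonicalNorm_iff {O : Type u} [CommRing O] [IsDomain O]
    [IsDiscreteValuationRing O] [Finite (O ⧸ IsLocalRing.maximalIdeal O)] {E : Type v} [Field E]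
    [Algebra O E] [IsFractionRing O E] {n : ℕ} (q : MvPolynomial (Fin n) O) :
    IsEuclideanForm (canonicalNorm O) E q ↔
      ∀ x : Fin n → E, IsIntegralOnCoset q x → x ∈ standardLattice O E n := by
  refine forall_congr' fun x => ?_
  simp only [fracNorm_canonicalNorm_mem_Ioo_iff]
  rw [← not_forall, not_imp_not]
  rfl

theorem valuation_aeval_le_one {R : Type u} [CommRing R] {K : Type v} [CommRing K] [Algebra R K]
    {Γ : Type*} [LinearOrderedCommMonoidWithZero Γ] (v : Valuation K Γ)
    (hv : ∀ a, v (algebraMap R K a) ≤ 1) {ι : Type*} {x : ι → K} (hx : ∀ i, v (x i) ≤ 1)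
    (p : MvPolynomial ι R) : v (MvPolynomial.aeval x p) ≤ 1 := by
  induction p using MvPolynomial.induction_on with
  | C a => simpa using hv a
  | add p q hp hq =>
    rw [map_add]
    exact Valuation.map_add_le _ hp hq
  | mul_X p i hp =>
    rw [map_mul, map_mul, MvPolynomial.aeval_X]
    exact mul_le_one' hp (hx i)

/-! ### The local-global principle -/

section LocalGlobal

variable {R : Type u} [CommRing R] [IsDedekindDomain R] {K : Type v} [Field K] [Algebra R K]
  [IsFractionRing R K]

theorem algebraMap_mem_range_adicCompletionIntegers_iff (w : HeightOneSpectrum R) (k : K) :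
    algebraMap K (w.adicCompletion K) k ∈
        (algebraMap (w.adicCompletionIntegers K) (w.adicCompletion K)).range ↔
      w.valuation K k ≤ 1 := by
  rw [← HeightOneSpectrum.valuedAdicCompletion_eq_valuation',
    ← HeightOneSpectrum.mem_adicCompletionIntegers R K w]
  refine ⟨fun ⟨y, hy⟩ => ?_, fun h => ⟨⟨_, h⟩, rfl⟩⟩
  change algebraMap K (w.adicCompletion K) k ∈ _
  exact hy ▸ y.2

theorem mem_range_algebraMap_iff_forall_valuation_le_one (k : K) :
    k ∈ (algebraMap R K).range ↔ ∀ w : HeightOneSpectrum R, w.valuation K k ≤ 1 :=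
  ⟨fun ⟨a, ha⟩ w => ha ▸ w.valuation_le_one a,
    HeightOneSpectrum.mem_integers_of_valuation_le_one K k⟩

theorem aeval_adicCompletion_map (w : HeightOneSpectrum R) {n : ℕ} (p : MvPolynomial (Fin n) R)
    (x : Fin n → K) :
    MvPolynomial.aeval (fun i => algebraMap K (w.adicCompletion K) (x i))
        (MvPolynomial.map (algebraMap R (w.adicCompletionIntegers K)) p) =
      algebraMap K (w.adicCompletion K) (MvPolynomial.aeval x p) := by
  rw [MvPolynomial.aeval_map_algebraMap]
  exact MvPolynomial.aeval_algebraMap_apply (w.adicCompletion K) x p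

theorem IsIntegralOnCoset.adicCompletion {n : ℕ} {q : MvPolynomial (Fin n) R}
    (hq : q.IsHomogeneous 2) {x : Fin n → K} (hx : IsIntegralOnCoset q x)
    (w : HeightOneSpectrum R) :
    IsIntegralOnCoset (MvPolynomial.map (algebraMap R (w.adicCompletionIntegers K)) q)
      fun i => algebraMap K (w.adicCompletion K) (x i) := by
  obtain ⟨h0, h1⟩ := (isIntegralOnCoset_iff hq x).1 hx
  rw [isIntegralOnCoset_iff (hq.map _)]
  simp only [MvPolynomial.pderiv_map, aeval_adicCompletion_map,
    algebraMap_mem_range_adicCompletionIntegers_iff]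
  simp only [mem_range_algebraMap_iff_forall_valuation_le_one] at h0 h1
  exact ⟨h0 w, fun j => h1 j w⟩

/-- A vector over a completion whose coset is integral is congruent modulo the local standard
lattice to a global vector whose coset is integral. -/
theorem exists_isIntegralOnCoset_of_adicCompletion (w : HeightOneSpectrum R) {n : ℕ}
    {q : MvPolynomial (Fin n) R} {x : Fin n → w.adicCompletion K}
    (hx : IsIntegralOnCoset (MvPolynomial.map (algebraMap R (w.adicCompletionIntegers K)) q) x) :
    ∃ x' : Fin n → K, IsIntegralOnCoset q x' ∧ ∃ z : Fin n → w.adicCompletionIntegers K,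
      ∀ i, algebraMap K (w.adicCompletion K) (x' i) = x i - z i := by
  choose k hk using fun i => exists_valued_sub_coe_lt_one w (x i)
  -- Passing from the approximation `k` to `x'` costs only a `w`-integral vector, which is absorbed
  -- in `z`.
  obtain ⟨x', hx', hx't⟩ := exists_forall_valuation_le_one w k
  let z : Fin n → w.adicCompletionIntegers K := fun i =>
    ⟨x i - algebraMap K (w.adicCompletion K) (x' i), by
      have : x i - algebraMap K (w.adicCompletion K) (x' i) =
          (x i - algebraMap K (w.adicCompletion K) (k i)) -
            algebraMap K (w.adicCompletion K) (x' i - k i) := by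
        rw [map_sub]
        ring
      rw [this]
      refine sub_mem (hk i).le ?_
      obtain ⟨y, hy⟩ := (algebraMap_mem_range_adicCompletionIntegers_iff w _).2 (hx' i)
      exact hy ▸ y.2⟩
  have hz : ∀ i, algebraMap K (w.adicCompletion K) (x' i) = x i - z i := fun i =>
    (sub_sub_cancel _ _).symm
  refine ⟨x', fun y => ?_, z, hz⟩
  rw [mem_range_algebraMap_iff_forall_valuation_le_one]
  intro t
  by_cases ht : t = w
  · subst ht
    rw [← algebraMap_mem_range_adicCompletionIntegers_iff, ← aeval_adicCompletion_map]
    -- At `w`, the vector `x' - y = x - z - y` lies in the local coset of `x`. At the other primes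
    -- it is itself integral, hence so is its value under `q`.
    have h := hx.sub_algebraMap z fun i => algebraMap R (t.adicCompletionIntegers K) (y i)
    have hvec : (fun i => algebraMap K (t.adicCompletion K) (x' i - algebraMap R K (y i))) =
        fun i => x i - (z i : t.adicCompletion K) -
          algebraMap K (t.adicCompletion K) (algebraMap R K (y i)) := by
      ext1 i
      rw [map_sub, hz]
    rw [hvec]
    exact h
  · exact valuation_aeval_le_one _ (fun a => t.valuation_le_one a)
      (fun i => Valuation.map_sub_le _ (hx't t ht i) (t.valuation_le_one (y i))) q

end LocalGlobal

theorem corollary22 {R : Type u} [CommRing R] [IsHasseDomain R] (h2 : ringChar R ≠ 2)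
    (K : Type v) [Field K] [Algebra R K] [IsFractionRing R K] {n : ℕ}
    (q : MvPolynomial (Fin n) R) (hq : q.IsHomogeneous 2) (hnd : IsNondegenerateForm K q) :
    IsLocallyEuclidean K q ↔
      IsMaximalQuadraticLattice (fun x : Fin n → K => MvPolynomial.aeval x q)
        (standardLattice R K n) := by
  have hlocal : IsLocallyEuclidean K q ↔ ∀ (w : HeightOneSpectrum R)
      (x : Fin n → w.adicCompletion K),
      IsIntegralOnCoset (MvPolynomial.map (algebraMap R (w.adicCompletionIntegers K)) q) x →
        x ∈ standardLattice (w.adicCompletionIntegers K) (w.adicCompletion K) n := by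
    refine forall_congr' fun w => ?_
    have := IsHasseDomain.finite_quotient w
    have := finite_quotient_maximalIdeal_adicCompletionIntegers (K := K) w
    exact isEuclideanForm_canonicalNorm_iff _
  rw [hlocal, isMaximalQuadraticLattice_standardLattice_iff hq]
  constructor
  · intro h x hx
    refine mem_standardLattice.2 fun i =>
      (mem_range_algebraMap_iff_forall_valuation_le_one _).2 fun w => ?_
    exact (algebraMap_mem_range_adicCompletionIntegers_iff w _).1
      (mem_standardLattice.1 (h w _ (hx.adicCompletion hq w)) i)
  · intro h w x hx
    obtain ⟨x', hx', z, hz⟩ := exists_isIntegralOnCoset_of_adicCompletion w hx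
    refine mem_standardLattice.2 fun i => ?_
    have hmem := (algebraMap_mem_range_adicCompletionIntegers_iff w (x' i)).2
      ((mem_range_algebraMap_iff_forall_valuation_le_one _).1
        (mem_standardLattice.1 (h x' hx') i) w)
    rw [hz] at hmem
    simpa using add_mem hmem ⟨z i, rfl⟩
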